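/- All graphs are finite and simple. A graph is \emph{chordal} if it has no induced cycle of length greater than $3$; $G$ is \emph{co-chordal} if its complement $G^c$ is chordal. A \emph{clique tree} of a chordal graph $H$ is a tree whose nodes are the maximal cliques of $H$ and in which every clique on the path between two nodes $K,K'$ contains $K\cap K'$. For an edge $e=KK'$ of a clique tree put $\operatorname{mid}(e)=K\cap K'$. A \emph{biclique} $\{L,R\}$ of $G$ consists of two nonempty disjoint vertex sets with every vertex of $L$ adjacent in $G$ to every vertex of $R$; a \emph{biclique cover} of $G$ is a set of bicliques of $G$ such that every edge of $G$ joins the two sides of at least one of them, and $\operatorname{bc}(G)$ is the minimum size of a biclique cover. An \emph{edge-ranking} of a tree $T$ with $r$ ranks is a map $\varphi:E(T)\to\{1,\dots,r\}$ such that for any two distinct edges $e_1,e_2$ with $\varphi(e_1)=\varphi(e_2)$ some edge $e_3$ on the path between them has $\varphi(e_3)>\varphi(e_1)$; $\chi_r'(T)$ is the minimum number of ranks of an edge-ranking of $T$, and an edge-ranking is \emph{optimal} if it uses $\chi'_r(T)$ ranks. Given $G$ and a clique tree $T$ of $G^c$, consider the following algorithm. Choose an optimal edge-ranking $\varphi$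 of $T$, put $r=\chi_r'(T)$, and number the nodes of $T$ by $\sigma$ in the order of a breadth-first search started at a leaf (the only node, if $T$ has just one node). Start with empty lists $B_1,\dots,B_r$ and call $\mathrm{FindBiclique}(T)$, where $\mathrm{FindBiclique}(T')$ for a subtree $T'$ does nothing if $T'$ has at most one node, and otherwise picks an edge $e$ of $T'$ with $\varphi(e)$ maximum, lets $T_1,T_2$ be the two components of $T'\setminus e$, adds to $B_{r+1-\varphi(e)}$ the biclique $\{L,R\}$ with $$L=\bigcup_{K\in V(T_1)}K\setminus\operatorname{mid}(e),\qquad R=\bigcup_{K\in V(T_2)}K\setminus\operatorname{mid}(e)$$ and with sorting key $\min\{\sigma(K):K\in V(T')\}$, and then calls $\mathrm{FindBiclique}(T_1)$ and $\mathrm{FindBiclique}(T_2)$. Then, for each level $i=1,\dots,r$, start with $C_i=\emptyset$ and go through the bicliques $\{L,R\}$ of $B_i$ in ascending order of their keys: replace each member $\{L',R'\}$ of $C_i$ by $\{L\cup L',R\cup R'\}$ if this is a biclique of $G$, else by $\{R\cup L',L\cup R'\}$ if this is a biclique of $G$; if no member of $C_i$ could be so replaced, add $\{L,R\}$ to $C_i$.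 Return $C_1\cup\dots\cup C_r$. \textbf{Theorem.} Let $G$ be a co-chordal graph such that each vertex of $G$ is in at most two maximal independent sets of $G$, and let $T$ be any clique tree of $G^c$. Then the algorithm, with every way of making its choices, returns a biclique cover of $G$ of size at most $\chi_r'(T)$. Consequently $\operatorname{bc}(G)\le\chi_r'(T)$. -/

import Mathlib

namespace BicliqueBound

universe u

/-! ### Chordal graphs, maximal cliques, clique trees -/

/-- A graph is chordal if it has no induced cycle of length greater than 3. -/
def IsChordal {V : Type u} (H : SimpleGraph V) : Prop :=
  ∀ n : ℕ, 3 < n → IsEmpty (SimpleGraph.cycleGraph n ↪g H)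

/-- A graph is co-chordal if its complement is chordal. -/
def IsCoChordal {V : Type u} (G : SimpleGraph V) : Prop :=
  IsChordal Gᶜ

/-- Every vertex of `G` lies in at most two maximal independent sets of `G`. -/
def InAtMostTwoMaxIndepSets {V : Type u} [Fintype V] (G : SimpleGraph V) : Prop :=
  ∀ v : V, {I : Finset V | Maximal (fun s : Finset V => G.IsIndepSet (s : Set V)) I ∧ v ∈ I}.ncard ≤ 2

/-- The type of all maximal cliques of `H`. -/
def MaxClique {V : Type u} (H : SimpleGraph V) : Type u :=
  {K : Finset V // Maximal (fun s : Finset V => H.IsClique (s : Set V)) K}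

/-- The vertex set of a maximal clique. -/
def MaxClique.verts {V : Type u} {H : SimpleGraph V} (K : MaxClique H) : Finset V := K.1

instance MaxClique.instFinite {V : Type u} [Fintype V] (H : SimpleGraph V) : Finite (MaxClique H) :=
  inferInstanceAs (Finite {K : Finset V // Maximal (fun s : Finset V => H.IsClique (s : Set V)) K})

noncomputable instance MaxClique.instFintype {V : Type u} [Fintype V] (H : SimpleGraph V) :
    Fintype (MaxClique H) := Fintype.ofFinite _

/-- `T` is a clique tree of `H`: a tree whose nodes are the maximal cliques of `H`, such that every
clique on the path between `K₁` and `K₂` contains `K₁ ∩ K₂`. -/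
structure IsCliqueTree {V : Type u} [DecidableEq V] (H : SimpleGraph V)
    (T : SimpleGraph (MaxClique H)) : Prop where
  isTree : T.IsTree
  inter_subset : ∀ (K₁ K₂ : MaxClique H) (p : T.Walk K₁ K₂), p.IsPath →
    ∀ K ∈ p.support, K₁.verts ∩ K₂.verts ⊆ K.verts

/-! ### Edge-rankings of trees -/

/-- `φ` is an edge-ranking of the tree `T` with ranks `1, …, r`: whenever two distinct edges have the
same rank, the path joining them has an edge of larger rank. (Only the values of `φ` on edges of `T`
matter. In a tree, a path through both edges consists of the path joining them, possibly prolonged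
beyond them; the condition for all such paths amounts to the condition for the shortest one.) -/
def IsEdgeRanking {N : Type u} (T : SimpleGraph N) (r : ℕ) (φ : Sym2 N → ℕ) : Prop :=
  (∀ e ∈ T.edgeSet, 1 ≤ φ e ∧ φ e ≤ r) ∧
  ∀ (a b : N) (p : T.Walk a b), p.IsPath →
    ∀ e₁ ∈ p.edges, ∀ e₂ ∈ p.edges, e₁ ≠ e₂ → φ e₁ = φ e₂ → ∃ e₃ ∈ p.edges, φ e₁ < φ e₃

/-- The optimal edge-ranking number `χ'_r(T)`. -/
noncomputable def edgeRankingNumber {N : Type u} (T : SimpleGraph N) : ℕ :=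
  sInf {r : ℕ | ∃ φ : Sym2 N → ℕ, IsEdgeRanking T r φ}

/-- `φ` is an optimal edge-ranking of `T`. -/
def IsOptimalEdgeRanking {N : Type u} (T : SimpleGraph N) (φ : Sym2 N → ℕ) : Prop :=
  IsEdgeRanking T (edgeRankingNumber T) φ

/-! ### Bicliques and biclique covers -/

/-- The biclique with sides `L` and `R`, given as the pair `(L, R)`. -/
abbrev Biclique (V : Type u) : Type u := Finset V × Finset V

/-- `{L, R}` is a biclique subgraph of `G`. (The sides are then automatically disjoint.) -/
def IsBiclique {V : Type u} (G : SimpleGraph V) (b : Biclique V) : Prop :=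
  b.1.Nonempty ∧ b.2.Nonempty ∧ ∀ u ∈ b.1, ∀ v ∈ b.2, G.Adj u v

/-- `C` is a biclique cover of `G`. -/
def IsBicliqueCover {V : Type u} (G : SimpleGraph V) (C : Finset (Biclique V)) : Prop :=
  (∀ b ∈ C, IsBiclique G b) ∧
  ∀ u v : V, G.Adj u v → ∃ b ∈ C, (u ∈ b.1 ∧ v ∈ b.2) ∨ (v ∈ b.1 ∧ u ∈ b.2)

/-- The biclique cover number `bc(G)`. -/
noncomputable def bicliqueCoverNumber {V : Type u} (G : SimpleGraph V) : ℕ :=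
  sInf {n : ℕ | ∃ C : Finset (Biclique V), IsBicliqueCover G C ∧ C.card = n}

/-! ### Breadth-first search -/

/-- A leaf of a tree. (The only node of a one-node tree counts as a leaf.) -/
def IsLeaf {N : Type u} (T : SimpleGraph N) (v : N) : Prop :=
  (T.neighborSet v).Subsingleton

/-- Breadth-first search from `root`. In the state `(l, i)`, the list `l` holds the nodes discovered
so far in order of discovery and the first `i` of them are processed, so that the rest of `l` is the
queue. A step processes `l[i]` and appends its undiscovered neighbours, in arbitrary order. -/
inductive BFSState {N : Type u} (T : SimpleGraph N) (root : N) : List N → ℕ → Prop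
  | start : BFSState T root [root] 0
  | step (l new : List N) (i : ℕ) (hi : i < l.length) (hnodup : new.Nodup)
      (hnew : ∀ K, K ∈ new ↔ T.Adj l[i] K ∧ K ∉ l) (h : BFSState T root l i) :
      BFSState T root (l ++ new) (i + 1)

/-- `σ` numbers the nodes `1, 2, …` in the order in which some breadth-first search from `root`
visits them. -/
def IsBFSOrdering {N : Type u} (T : SimpleGraph N) (root : N) (σ : N → ℕ) : Prop :=
  ∃ l : List N, BFSState T root l l.length ∧ ∀ (i : ℕ) (hi : i < l.length), σ l[i] = i + 1

/-! ### The algorithm -/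

open Classical in
/-- A subtree of `T` is given by its node set `S`. Cutting it along its edge `K₁K₂` leaves two
subtrees; this is the node set of the one that contains `K₁`. -/
noncomputable def cutSide {N : Type u} (T : SimpleGraph N) (S : Finset N) (K₁ K₂ : N) : Finset N :=
  S.filter fun K => ∃ p : T.Walk K₁ K, (∀ A ∈ p.support, A ∈ S) ∧ s(K₁, K₂) ∉ p.edges

/-- One side of the biclique read off a cut: the vertices of the cliques in `S₁`, without the middle
set `K₁ ∩ K₂` of the cut edge. -/
def sideVerts {V : Type u} [DecidableEq V] {H : SimpleGraph V} (S₁ : Finset (MaxClique H))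
    (K₁ K₂ : MaxClique H) : Finset V :=
  S₁.biUnion MaxClique.verts \ (K₁.verts ∩ K₂.verts)

/-- The dictionary that stores, for each level, a list of bicliques with their sorting keys. -/
abbrev LevelDict (V : Type u) : Type u := ℕ → List (Biclique V × ℕ)

/-- The recursive subroutine: `FindBiclique T φ σ r S D D'` means that the call on the subtree with
node set `S` and dictionary `D` can end with the dictionary `D'`. On a subtree with more than one
node, it cuts along an edge `K₁K₂` of largest rank, adds the biclique of that cut to level
`r + 1 - φ(K₁K₂)` with the smallest BFS number in `S` as sorting key, and continues on both sides. -/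
inductive FindBiclique {V : Type u} [DecidableEq V] {H : SimpleGraph V}
    (T : SimpleGraph (MaxClique H)) (φ : Sym2 (MaxClique H) → ℕ) (σ : MaxClique H → ℕ) (r : ℕ) :
    Finset (MaxClique H) → LevelDict V → LevelDict V → Prop
  | done (S : Finset (MaxClique H)) (D : LevelDict V) (hS : S.card ≤ 1) :
      FindBiclique T φ σ r S D D
  | cut (S : Finset (MaxClique H)) (D D₀ D₁ D₂ : LevelDict V) (K₁ K₂ : MaxClique H) (level : ℕ)
      (hS : 1 < S.card) (h₁ : K₁ ∈ S) (h₂ : K₂ ∈ S) (hadj : T.Adj K₁ K₂)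
      (hmax : ∀ A ∈ S, ∀ B ∈ S, T.Adj A B → φ s(A, B) ≤ φ s(K₁, K₂))
      (hlevel : level = r + 1 - φ s(K₁, K₂))
      (hD₀ : D₀ = Function.update D level
        (D level ++ [((sideVerts (cutSide T S K₁ K₂) K₁ K₂, sideVerts (cutSide T S K₂ K₁) K₁ K₂),
          S.inf' ⟨K₁, h₁⟩ σ)]))
      (hrec₁ : FindBiclique T φ σ r (cutSide T S K₁ K₂) D₀ D₁)
      (hrec₂ : FindBiclique T φ σ r (cutSide T S K₂ K₁) D₁ D₂) :
      FindBiclique T φ σ r S D D₂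

/-- `{L, R}` can be merged into `{L', R'}`, in one of the two ways. -/
def Mergeable {V : Type u} [DecidableEq V] (G : SimpleGraph V) (b b' : Biclique V) : Prop :=
  IsBiclique G (b.1 ∪ b'.1, b.2 ∪ b'.2) ∨ IsBiclique G (b.2 ∪ b'.1, b.1 ∪ b'.2)

open Classical in
/-- The new value of `{L', R'}` after an attempt to merge `{L, R}` into it. -/
noncomputable def mergeInto {V : Type u} [DecidableEq V] (G : SimpleGraph V) (b b' : Biclique V) :
    Biclique V :=
  if IsBiclique G (b.1 ∪ b'.1, b.2 ∪ b'.2) then (b.1 ∪ b'.1, b.2 ∪ b'.2)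
  else if IsBiclique G (b.2 ∪ b'.1, b.1 ∪ b'.2) then (b.2 ∪ b'.1, b.1 ∪ b'.2)
  else b'

open Classical in
/-- Process one biclique `{L, R}`: merge it into each member of `C` where that is possible, and add it
to `C` as a new member if it could not be merged into any. -/
noncomputable def mergeStep {V : Type u} [DecidableEq V] (G : SimpleGraph V)
    (C : Finset (Biclique V)) (b : Biclique V) : Finset (Biclique V) :=
  if ∃ b' ∈ C, Mergeable G b b' then C.image (mergeInto G b) else insert b C

/-- The merging subroutine: sort by the keys, then process the bicliques one after the other. -/
noncomputable def mergeBiclique {V : Type u} [DecidableEq V] (G : SimpleGraph V)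
    (l : List (Biclique V × ℕ)) : Finset (Biclique V) :=
  ((l.mergeSort fun x y => decide (x.2 ≤ y.2)).map Prod.fst).foldl (mergeStep G) ∅

/-- The algorithm on `G` with clique tree `T` of the complement, optimal edge-ranking `φ` of `T` and
breadth-first ordering `σ` of `T` can return `C`: run `FindBiclique` on all of `T` with the empty
dictionary, merge the bicliques of each level `1, …, r` where `r` is the number of ranks of `φ`, and
collect the results. -/
def AlgorithmReturns {V : Type u} [Fintype V] [DecidableEq V] (G : SimpleGraph V)
    (T : SimpleGraph (MaxClique Gᶜ)) (φ : Sym2 (MaxClique Gᶜ) → ℕ) (σ : MaxClique Gᶜ → ℕ)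
    (C : Finset (Biclique V)) : Prop :=
  ∃ D : LevelDict V,
    FindBiclique T φ σ (edgeRankingNumber T) Finset.univ (fun _ => []) D ∧
    C = (Finset.Icc 1 (edgeRankingNumber T)).biUnion fun i => mergeBiclique G (D i)

end BicliqueBound

open BicliqueBound

/-! Covering does not depend on the ranking. If `u` and `v` are adjacent in `G`, no node of `T`
contains both. Follow the recursion with a subtree in which both occur. If one of them lies in the
middle set of the cut, it occurs in both parts, so the part containing the other keeps both;
otherwise the cut either separates them and its biclique covers `uv`, or leaves them in one part. A
single node cannot be reached, so some cut covers `uv` (`FindBiclique.exists_covers`), and merging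
only enlarges sides.

For the size, each level has to collapse to one biclique. By the ranking condition a maximum edge of
a subtree is the only edge of its rank there, so the entries of one level come from pairwise
disjoint subtrees (`FindBiclique.exists_entries`). Since a vertex lies in at most two nodes, two
nodes sharing a vertex are adjacent in `T` (`IsCliqueTree.adj_of_mem`). Regard `T` as rooted by the
search order. If a vertex `z` of a subtree with first node `t` and a vertex `x` of an earlier
disjoint subtree are non-adjacent in `G`, then `z` lies in `t` and `x` in the parent of `t`
(`IsCliqueTree.conflict_mem_parent`). Outside the middle set, the vertices of `t` lie on one side of
the new biclique; those of the parent are pairwise non-adjacent, so they meet only one side of the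
biclique accumulated so far. Putting these two sides together gives a valid merge
(`mergeable_of_conflict`), and by induction a level never holds more than one biclique
(`foldl_mergeStep`). -/

namespace BicliqueBound

universe u

open SimpleGraph

/-! ### Cutting subtrees -/

section Tree

variable {N : Type u} {T : SimpleGraph N}

/-- The node set `S` induces a connected subgraph of `T`. -/
def ConnectedIn (T : SimpleGraph N) (S : Finset N) : Prop :=
  ∀ A ∈ S, ∀ B ∈ S, ∃ p : T.Walk A B, ∀ C ∈ p.support, C ∈ S

theorem connectedIn_univ [Fintype N] (hT : T.Connected) : ConnectedIn T Finset.univ := fun A _ B _ =>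
  let ⟨p⟩ := hT.preconnected A B
  ⟨p, fun _ _ => Finset.mem_univ _⟩

theorem mem_edges_of_isAcyclic (hT : T.IsAcyclic) {A B : N} (h : T.Adj A B) (p : T.Walk A B) :
    s(A, B) ∈ p.edges :=
  isBridge_iff_forall_walk_mem_edges.1 (isAcyclic_iff_forall_adj_isBridge.1 hT h) p

theorem ConnectedIn.exists_isPath {S : Finset N} (hS : ConnectedIn T S) {A B : N} (hA : A ∈ S)
    (hB : B ∈ S) : ∃ p : T.Walk A B, p.IsPath ∧ ∀ C ∈ p.support, C ∈ S := by
  classical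
  obtain ⟨p, hp⟩ := hS A hA B hB
  exact ⟨p.bypass, p.bypass_isPath, fun C hC => hp C (p.support_bypass_subset_support hC)⟩

theorem mem_cutSide {S : Finset N} {K₁ K₂ K : N} :
    K ∈ cutSide T S K₁ K₂ ↔
      ∃ p : T.Walk K₁ K, (∀ A ∈ p.support, A ∈ S) ∧ s(K₁, K₂) ∉ p.edges := by
  classical
  simp only [cutSide, Finset.mem_filter, and_iff_right_iff_imp]
  rintro ⟨p, hp, -⟩
  exact hp _ p.end_mem_support

theorem cutSide_subset (S : Finset N) (K₁ K₂ : N) : cutSide T S K₁ K₂ ⊆ S := by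
  intro K hK
  obtain ⟨p, hp, -⟩ := mem_cutSide.1 hK
  exact hp _ p.end_mem_support

theorem left_mem_cutSide {S : Finset N} {K₁ K₂ : N} (h₁ : K₁ ∈ S) : K₁ ∈ cutSide T S K₁ K₂ :=
  mem_cutSide.2 ⟨.nil, by simpa using h₁, by simp⟩

theorem disjoint_cutSide (hT : T.IsAcyclic) {S : Finset N} {K₁ K₂ : N} (h : T.Adj K₁ K₂) :
    Disjoint (cutSide T S K₁ K₂) (cutSide T S K₂ K₁) := by
  rw [Finset.disjoint_left]
  intro K hK hK'
  obtain ⟨p, -, hp⟩ := mem_cutSide.1 hK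
  obtain ⟨q, -, hq⟩ := mem_cutSide.1 hK'
  have := mem_edges_of_isAcyclic hT h (p.append q.reverse)
  rw [Walk.edges_append, List.mem_append, Walk.edges_reverse, List.mem_reverse] at this
  rw [Sym2.eq_swap] at hq
  tauto

theorem mem_cutSide_or {S : Finset N} (hS : ConnectedIn T S) {K₁ K₂ K : N} (h₁ : K₁ ∈ S)
    (hK : K ∈ S) : K ∈ cutSide T S K₁ K₂ ∨ K ∈ cutSide T S K₂ K₁ := by
  obtain ⟨p, hp, hpS⟩ := hS.exists_isPath h₁ hK
  by_cases he : s(K₁, K₂) ∈ p.edges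
  · right
    cases p with
    | nil => simp at he
    | @cons _ v _ h q =>
      rw [Walk.cons_isPath_iff] at hp
      -- A path from `K₁` can use the edge `K₁K₂` only as its first step, since it never returns to
      -- `K₁`; the rest of it starts at `K₂`.
      have hq : s(K₁, K₂) ∉ q.edges := fun h' => hp.2 (q.fst_mem_support_of_mem_edges h')
      rw [Walk.edges_cons, List.mem_cons, or_iff_left hq, Sym2.congr_right] at he
      subst he
      rw [Sym2.eq_swap] at hq
      exact mem_cutSide.2 ⟨q, fun A hA => hpS A (by simp [hA]), hq⟩
  · exact Or.inl (mem_cutSide.2 ⟨p, hpS, he⟩)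

theorem connectedIn_cutSide (S : Finset N) (K₁ K₂ : N) :
    ConnectedIn T (cutSide T S K₁ K₂) := by
  classical
  have key : ∀ A ∈ cutSide T S K₁ K₂, ∃ p : T.Walk K₁ A,
      ∀ C ∈ p.support, C ∈ cutSide T S K₁ K₂ := by
    intro A hA
    obtain ⟨p, hp, he⟩ := mem_cutSide.1 hA
    refine ⟨p, fun C hC => mem_cutSide.2 ⟨p.takeUntil C hC, fun D hD => hp D ?_, fun h => he ?_⟩⟩
    · exact p.support_takeUntil_subset_support hC hD
    · exact p.edges_takeUntil_subset_edges hC h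
  intro A hA B hB
  obtain ⟨p, hp⟩ := key A hA
  obtain ⟨q, hq⟩ := key B hB
  refine ⟨p.reverse.append q, fun C hC => ?_⟩
  rw [Walk.mem_support_append_iff, Walk.support_reverse, List.mem_reverse] at hC
  exact hC.elim (hp C) (hq C)

theorem right_notMem_cutSide (hT : T.IsAcyclic) {S : Finset N} {K₁ K₂ : N} (h : T.Adj K₁ K₂) :
    K₂ ∉ cutSide T S K₁ K₂ := by
  intro hK
  obtain ⟨p, -, hp⟩ := mem_cutSide.1 hK
  exact hp (mem_edges_of_isAcyclic hT h p)

/-- Otherwise going from `K₁` to `A`, along `w`, and from `B` to `K₂` would avoid the edge `K₁K₂`,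
which is a bridge. -/
theorem mem_edges_of_cutSide (hT : T.IsAcyclic) {S : Finset N} {K₁ K₂ A B : N}
    (h : T.Adj K₁ K₂) (hA : A ∈ cutSide T S K₁ K₂) (hB : B ∈ cutSide T S K₂ K₁)
    (w : T.Walk A B) : s(K₁, K₂) ∈ w.edges := by
  obtain ⟨p, -, hp⟩ := mem_cutSide.1 hA
  obtain ⟨q, -, hq⟩ := mem_cutSide.1 hB
  have := mem_edges_of_isAcyclic hT h ((p.append w).append q.reverse)
  rw [Walk.edges_append, List.mem_append, Walk.edges_append, List.mem_append, Walk.edges_reverse,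
    List.mem_reverse] at this
  rw [Sym2.eq_swap] at hq
  tauto

/-- An edge of maximum rank in a subtree is the only one of its rank. -/
theorem IsEdgeRanking.lt_of_mem_cutSide (hT : T.IsAcyclic) {r : ℕ} {φ : Sym2 N → ℕ}
    (hφ : IsEdgeRanking T r φ) {S : Finset N} (hS : ConnectedIn T S) {K₁ K₂ : N} (h₂ : K₂ ∈ S)
    (h : T.Adj K₁ K₂) (hmax : ∀ A ∈ S, ∀ B ∈ S, T.Adj A B → φ s(A, B) ≤ φ s(K₁, K₂)) {A B : N}
    (hA : A ∈ cutSide T S K₁ K₂) (hB : B ∈ cutSide T S K₁ K₂) (hAB : T.Adj A B) :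
    φ s(A, B) < φ s(K₁, K₂) := by
  refine lt_of_le_of_ne (hmax A (cutSide_subset _ _ _ hA) B (cutSide_subset _ _ _ hB) hAB) ?_
  intro heq
  have hne : s(A, B) ≠ s(K₁, K₂) := by
    intro he
    have hK := right_notMem_cutSide (S := S) hT h
    rcases Sym2.eq_iff.1 he with ⟨-, rfl⟩ | ⟨rfl, -⟩
    exacts [hK hB, hK hA]
  -- Such a path crosses the cut edge. If it also contained `AB`, of equal rank, the ranking would
  -- require an edge of larger rank on it, inside `S`, against maximality.
  have no_path : ∀ C ∈ cutSide T S K₁ K₂, ∀ p : T.Walk C K₂, p.IsPath →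
      (∀ D ∈ p.support, D ∈ S) → s(A, B) ∉ p.edges := by
    intro C hC p hp hpS hmem
    obtain ⟨e, he, hlt⟩ := hφ.2 _ _ p hp _ hmem _
      (mem_edges_of_cutSide hT h hC (left_mem_cutSide h₂) p) hne heq
    induction e using Sym2.ind with
    | _ x y =>
      have := hmax x (hpS x (p.fst_mem_support_of_mem_edges he)) y
        (hpS y (p.snd_mem_support_of_mem_edges he)) (p.adj_of_mem_edges he)
      omega
  -- Joining `A` to `B` through `K₂` must use the bridge `AB`, so one of the two halves contains it.
  obtain ⟨p, hp, hpS⟩ := hS.exists_isPath (cutSide_subset _ _ _ hA) h₂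
  obtain ⟨q, hq, hqS⟩ := hS.exists_isPath (cutSide_subset _ _ _ hB) h₂
  have := mem_edges_of_isAcyclic hT hAB (p.append q.reverse)
  rw [Walk.edges_append, List.mem_append, Walk.edges_reverse, List.mem_reverse] at this
  exact this.elim (no_path A hA p hp hpS) (no_path B hB q hq hqS)

/-- Pairwise distinct ranks satisfy the condition vacuously, so the set of possible `r` is nonempty
and its infimum is attained. -/
theorem exists_isOptimalEdgeRanking [Finite N] (T : SimpleGraph N) :
    ∃ φ, IsOptimalEdgeRanking T φ := by
  classical
  have : Nonempty (Fintype (Sym2 N)) := nonempty_fintype _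
  obtain ⟨inst⟩ := this
  refine Nat.sInf_mem (s := {r : ℕ | ∃ φ : Sym2 N → ℕ, IsEdgeRanking T r φ})
    ⟨Fintype.card (Sym2 N), fun e => Fintype.equivFin _ e + 1, fun e _ => ⟨by simp, ?_⟩, ?_⟩
  · exact (Fintype.equivFin _ e).2
  · intro a b p _ e₁ _ e₂ _ hne heq
    exact absurd (by simpa [Fin.val_inj] using heq) hne

theorem exists_isLeaf [Finite N] (hT : T.IsTree) : ∃ v, IsLeaf T v := by
  classical
  have := Fintype.ofFinite N
  rcases subsingleton_or_nontrivial N with h | h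
  · obtain ⟨v⟩ := hT.connected.nonempty
    exact ⟨v, Set.subsingleton_of_subsingleton⟩
  · obtain ⟨v, hv⟩ := hT.exists_vert_degree_one_of_nontrivial
    obtain ⟨w, hw, huniq⟩ := degree_eq_one_iff_existsUnique_adj.1 hv
    exact ⟨v, fun a ha b hb => (huniq a ha).trans (huniq b hb).symm⟩

/-! ### Breadth-first search -/

theorem BFSState.nodup {root : N} {l : List N} {i : ℕ} (h : BFSState T root l i) : l.Nodup := by
  induction h with
  | start => simp
  | step l new i hi hnodup hnew _ ih =>
    exact List.nodup_append.2 ⟨ih, hnodup, fun a ha b hb hab => ((hnew b).1 hb).2 (hab ▸ ha)⟩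

theorem BFSState.le_length {root : N} {l : List N} {i : ℕ} (h : BFSState T root l i) :
    i ≤ l.length := by
  induction h with
  | start => simp
  | step l new i hi => rw [List.length_append]; omega

/-- Every step raises `i`, which is bounded by the number of nodes because the list has no
repetitions. -/
theorem BFSState.exists_complete [Finite N] {root : N} {l : List N} {i : ℕ}
    (h : BFSState T root l i) : ∃ l', BFSState T root l' l'.length := by
  classical
  have := Fintype.ofFinite N
  induction hk : Fintype.card N - i generalizing l i with
  | zero =>
    have h₁ := h.nodup.length_le_card
    have h₂ := h.le_length
    obtain rfl : i = l.length := by omega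
    exact ⟨l, h⟩
  | succ k ih =>
    rcases h.le_length.eq_or_lt with rfl | hi
    · exact ⟨l, h⟩
    · exact ih (BFSState.step l (Finset.univ.filter fun K => T.Adj l[i] K ∧ K ∉ l).toList i hi
        (Finset.nodup_toList _) (by simp) h) (by omega)

theorem exists_isBFSOrdering [Finite N] (T : SimpleGraph N) (root : N) :
    ∃ σ, IsBFSOrdering T root σ := by
  classical
  obtain ⟨l, hl⟩ := (BFSState.start (T := T) (root := root)).exists_complete
  exact ⟨fun K => l.idxOf K + 1, l, hl, fun i hi => by simp only [hl.nodup.idxOf_getElem]⟩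

theorem BFSState.root_mem {root : N} {l : List N} {i : ℕ} (h : BFSState T root l i) :
    root ∈ l := by
  induction h with
  | start => simp
  | step l new i hi hnodup hnew _ ih => exact List.mem_append_left _ ih

theorem BFSState.neighbor_mem {root : N} {l : List N} {i : ℕ} (h : BFSState T root l i)
    {j : ℕ} (hj : j < l.length) (hji : j < i) {K : N} (hK : T.Adj l[j] K) : K ∈ l := by
  induction h with
  | start => omega
  | step l new i hi hnodup hnew _ ih =>
    have hjl : j < l.length := by omega
    rw [List.getElem_append_left hjl] at hK
    by_cases hKl : K ∈ l
    · exact List.mem_append_left _ hKl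
    · rcases Nat.lt_succ_iff_lt_or_eq.1 hji with h | rfl
      · exact absurd (ih hjl h hK) hKl
      · exact List.mem_append_right _ ((hnew K).2 ⟨hK, hKl⟩)

theorem BFSState.exists_parent {root : N} {l : List N} {i : ℕ} (h : BFSState T root l i)
    {j : ℕ} (hj : j < l.length) (hne : l[j] ≠ root) :
    ∃ (k : ℕ) (hk : k < j), T.Adj l[j] l[k] := by
  induction h with
  | start => simp at hj; simp [hj] at hne
  | step l new i hi hnodup hnew _ ih =>
    by_cases hjl : j < l.length
    · rw [List.getElem_append_left hjl] at hne
      obtain ⟨k, hk, h⟩ := ih hjl hne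
      refine ⟨k, hk, ?_⟩
      rwa [List.getElem_append_left hjl, List.getElem_append_left]
    · refine ⟨i, by omega, ?_⟩
      rw [List.getElem_append_left hi, List.getElem_append_right (by omega)]
      exact ((hnew _).1 (List.getElem_mem _)).1.symm

theorem BFSState.mem_of_connected (hT : T.Connected) {root : N} {l : List N}
    (h : BFSState T root l l.length) (K : N) : K ∈ l := by
  obtain ⟨p⟩ := hT.preconnected root K
  suffices ∀ (A B : N) (p : T.Walk A B), A ∈ l → B ∈ l from this _ _ p h.root_mem
  intro A B p
  induction p with
  | nil => exact id
  | cons hadj _ ih =>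
    intro hA
    obtain ⟨j, hj, rfl⟩ := List.getElem_of_mem hA
    exact ih (h.neighbor_mem hj hj hadj)

/-- `σ` is injective and numbers the nodes of `T` in the order of some search from `root`. -/
structure IsSearchOrder (T : SimpleGraph N) (root : N) (σ : N → ℕ) : Prop where
  injective : Function.Injective σ
  exists_parent : ∀ K, K ≠ root → ∃ P, T.Adj K P ∧ σ P < σ K

theorem IsBFSOrdering.isSearchOrder (hT : T.Connected) {root : N} {σ : N → ℕ}
    (hσ : IsBFSOrdering T root σ) : IsSearchOrder T root σ := by
  obtain ⟨l, hl, hlσ⟩ := hσ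
  refine ⟨fun A B hAB => ?_, fun K hK => ?_⟩
  · obtain ⟨i, hi, rfl⟩ := List.getElem_of_mem (hl.mem_of_connected hT A)
    obtain ⟨j, hj, rfl⟩ := List.getElem_of_mem (hl.mem_of_connected hT B)
    rw [hlσ, hlσ] at hAB
    obtain rfl : i = j := by omega
    rfl
  · obtain ⟨j, hj, rfl⟩ := List.getElem_of_mem (hl.mem_of_connected hT K)
    obtain ⟨k, hk, h⟩ := hl.exists_parent hj hK
    exact ⟨_, h, by rw [hlσ, hlσ]; omega⟩

variable {root : N} {σ : N → ℕ}

theorem IsSearchOrder.exists_walk_root (hσ : IsSearchOrder T root σ) (K : N) :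
    ∃ p : T.Walk K root, ∀ A ∈ p.support, σ A ≤ σ K := by
  induction hn : σ K using Nat.strong_induction_on generalizing K with
  | _ n ih =>
    subst hn
    by_cases hK : K = root
    · subst hK
      exact ⟨.nil, by simp⟩
    · obtain ⟨P, hP, hlt⟩ := hσ.exists_parent K hK
      obtain ⟨p, hp⟩ := ih _ hlt P rfl
      refine ⟨.cons hP p, fun A hA => ?_⟩
      rw [Walk.support_cons, List.mem_cons] at hA
      rcases hA with rfl | hA
      · exact le_rfl
      · exact (hp A hA).trans hlt.le

/-- Initial segments of a search order are connected, through the root. -/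
theorem IsSearchOrder.exists_walk (hσ : IsSearchOrder T root σ) {A B : N} {n : ℕ}
    (hA : σ A < n) (hB : σ B < n) : ∃ p : T.Walk A B, ∀ C ∈ p.support, σ C < n := by
  obtain ⟨p, hp⟩ := hσ.exists_walk_root A
  obtain ⟨q, hq⟩ := hσ.exists_walk_root B
  refine ⟨p.append q.reverse, fun C hC => ?_⟩
  rw [Walk.mem_support_append_iff, Walk.support_reverse, List.mem_reverse] at hC
  exact hC.elim (fun h => (hp C h).trans_lt hA) (fun h => (hq C h).trans_lt hB)

/-- In a connected node set, only the first node can have an earlier neighbour outside. -/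
theorem IsSearchOrder.eq_min_of_parent_notMem (hT : T.IsAcyclic) (hσ : IsSearchOrder T root σ)
    {S : Finset N} (hS : ConnectedIn T S) {t A B : N} (ht : t ∈ S) (hmin : ∀ C ∈ S, σ t ≤ σ C)
    (hA : A ∈ S) (hAB : T.Adj A B) (hlt : σ B < σ A) (hB : B ∉ S) : A = t := by
  by_contra hne
  have htA : σ t < σ A := lt_of_le_of_ne (hmin A hA) fun h => hne (hσ.injective h).symm
  -- From `A` to `t` inside `S`, then to `B` through nodes before `A`: the first half misses `B` and
  -- the second misses `A`, so the bridge `AB` is avoided.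
  obtain ⟨p, hp⟩ := hS A hA t ht
  obtain ⟨q, hq⟩ := hσ.exists_walk htA hlt
  have := mem_edges_of_isAcyclic hT hAB (p.append q)
  rw [Walk.edges_append, List.mem_append] at this
  rcases this with h | h
  · exact hB (hp B (p.snd_mem_support_of_mem_edges h))
  · exact lt_irrefl _ (hq A (q.fst_mem_support_of_mem_edges h))

/-- Stepping from `K` to `Q` and on to `P` through nodes before `K` must use the bridge `KP`, and
only the first step touches `K`. -/
theorem IsSearchOrder.parent_unique (hT : T.IsAcyclic) (hσ : IsSearchOrder T root σ)
    {K P Q : N} (hP : T.Adj K P) (hPlt : σ P < σ K) (hQ : T.Adj K Q) (hQlt : σ Q < σ K) :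
    P = Q := by
  obtain ⟨q, hq⟩ := hσ.exists_walk hQlt hPlt
  have := mem_edges_of_isAcyclic hT hP (.cons hQ q)
  rw [Walk.edges_cons, List.mem_cons, Sym2.congr_right] at this
  exact this.resolve_right fun h => lt_irrefl _ (hq K (q.fst_mem_support_of_mem_edges h))

end Tree

/-! ### Maximal cliques and clique trees -/

section CliqueTree

variable {V : Type u}

theorem MaxClique.not_adj {G : SimpleGraph V} (K : MaxClique Gᶜ) {u v : V} (hu : u ∈ K.verts)
    (hv : v ∈ K.verts) : ¬G.Adj u v := by
  intro h
  exact (K.2.prop hu hv h.ne).2 h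

/-- The case `u = v` is included; it shows that every vertex lies in some node. -/
theorem MaxClique.exists_of_not_adj [Finite V] {G : SimpleGraph V} {u v : V} (h : ¬G.Adj u v) :
    ∃ K : MaxClique Gᶜ, u ∈ K.verts ∧ v ∈ K.verts := by
  classical
  have hc : Gᶜ.IsClique (({u, v} : Finset V) : Set V) := by
    rw [Finset.coe_pair, isClique_pair]
    exact fun hne => ⟨hne, h⟩
  obtain ⟨K, hle, hK⟩ := Finite.exists_le_maximal
    (p := fun s : Finset V => Gᶜ.IsClique (s : Set V)) hc
  exact ⟨⟨K, hK⟩, hle (by simp), hle (by simp)⟩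

theorem MaxClique.exists_mem_notMem {H : SimpleGraph V} {K₁ K₂ : MaxClique H} (hne : K₁ ≠ K₂) :
    ∃ v ∈ K₁.verts, v ∉ K₂.verts := by
  by_contra! h
  exact hne (Subtype.ext (K₁.2.eq_of_le K₂.2.prop h))

variable [DecidableEq V]

theorem mem_sideVerts {H : SimpleGraph V} {S : Finset (MaxClique H)} {K₁ K₂ : MaxClique H}
    {v : V} : v ∈ sideVerts S K₁ K₂ ↔
      (∃ A ∈ S, v ∈ A.verts) ∧ ¬(v ∈ K₁.verts ∧ v ∈ K₂.verts) := by
  simp [sideVerts]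

/-- The second node on the path from `A` to `B` also contains `v`; were it not `B`, there would be
three maximal independent sets through `v`. -/
theorem IsCliqueTree.adj_of_mem [Fintype V] {G : SimpleGraph V} (h2 : InAtMostTwoMaxIndepSets G)
    {T : SimpleGraph (MaxClique Gᶜ)} (hT : IsCliqueTree Gᶜ T) {A B : MaxClique Gᶜ} {v : V}
    (hA : v ∈ A.verts) (hB : v ∈ B.verts) (hne : A ≠ B) : T.Adj A B := by
  classical
  obtain ⟨p, hp⟩ := hT.isTree.connected.exists_isPath A B
  have hsub := hT.inter_subset A B p hp
  cases p with
  | nil => exact absurd rfl hne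
  | @cons _ C _ h q =>
    have hC : v ∈ C.verts := hsub C (by simp) (Finset.mem_inter.2 ⟨hA, hB⟩)
    suffices C = B from this ▸ h
    by_contra hCB
    have hcard : ({A.1, B.1, C.1} : Set (Finset V)).ncard = 3 :=
      Set.ncard_eq_three.2 ⟨_, _, _, fun h => hne (Subtype.ext h),
        fun h' => h.ne (Subtype.ext h'), fun h => hCB (Subtype.ext h.symm), rfl⟩
    have hle := Set.ncard_le_ncard (t := {I : Finset V |
      Maximal (fun s : Finset V => G.IsIndepSet (s : Set V)) I ∧ v ∈ I}) (s := {A.1, B.1, C.1}) (by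
        rintro I (rfl | rfl | rfl)
        · exact ⟨by simpa using A.2, hA⟩
        · exact ⟨by simpa using B.2, hB⟩
        · exact ⟨by simpa using C.2, hC⟩) (Set.toFinite _)
    have := h2 v
    omega

/-- Non-adjacent vertices from the two sides would share a node `C`. The walk from `A` through `C`
to `B` crosses the cut edge, and the half that crosses it forces `u` or `v` into the middle set.
Nonemptiness holds because distinct maximal cliques are incomparable. -/
theorem IsCliqueTree.isBiclique_cut [Finite V] {G : SimpleGraph V}
    {T : SimpleGraph (MaxClique Gᶜ)} (hT : IsCliqueTree Gᶜ T) {S : Finset (MaxClique Gᶜ)}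
    {K₁ K₂ : MaxClique Gᶜ} (h₁ : K₁ ∈ S) (h₂ : K₂ ∈ S) (h : T.Adj K₁ K₂) :
    IsBiclique G (sideVerts (cutSide T S K₁ K₂) K₁ K₂, sideVerts (cutSide T S K₂ K₁) K₁ K₂) := by
  refine ⟨?_, ?_, ?_⟩
  · obtain ⟨v, hv, hv'⟩ := MaxClique.exists_mem_notMem h.ne
    exact ⟨v, mem_sideVerts.2 ⟨⟨K₁, left_mem_cutSide h₁, hv⟩, fun h => hv' h.2⟩⟩
  · obtain ⟨v, hv, hv'⟩ := MaxClique.exists_mem_notMem h.ne'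
    exact ⟨v, mem_sideVerts.2 ⟨⟨K₂, left_mem_cutSide h₂, hv⟩, fun h => hv' h.1⟩⟩
  · intro u hu v hv
    obtain ⟨⟨A, hA, huA⟩, hu⟩ := mem_sideVerts.1 hu
    obtain ⟨⟨B, hB, hvB⟩, hv⟩ := mem_sideVerts.1 hv
    by_contra hadj
    obtain ⟨C, huC, hvC⟩ := MaxClique.exists_of_not_adj hadj
    obtain ⟨p, hp⟩ := hT.isTree.connected.exists_isPath A C
    obtain ⟨q, hq⟩ := hT.isTree.connected.exists_isPath C B
    have hmem := mem_edges_of_cutSide hT.isTree.isAcyclic h hA hB (p.append q)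
    rw [Walk.edges_append, List.mem_append] at hmem
    rcases hmem with he | he
    · have hpu := fun K hK => hT.inter_subset _ _ p hp K hK (Finset.mem_inter.2 ⟨huA, huC⟩)
      exact hu ⟨hpu _ (p.fst_mem_support_of_mem_edges he),
        hpu _ (p.snd_mem_support_of_mem_edges he)⟩
    · have hqv := fun K hK => hT.inter_subset _ _ q hq K hK (Finset.mem_inter.2 ⟨hvC, hvB⟩)
      exact hv ⟨hqv _ (q.fst_mem_support_of_mem_edges he),
        hqv _ (q.snd_mem_support_of_mem_edges he)⟩

/-- If a vertex `z` of a subtree and a vertex `x` of a disjoint subtree that starts earlier in the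
search order are not adjacent in `G`, then `z` lies in the first node of its subtree and `x` in the
parent of that node. -/
theorem IsCliqueTree.conflict_mem_parent [Fintype V] {G : SimpleGraph V}
    (h2 : InAtMostTwoMaxIndepSets G) {T : SimpleGraph (MaxClique Gᶜ)} (hT : IsCliqueTree Gᶜ T)
    {root : MaxClique Gᶜ} {σ : MaxClique Gᶜ → ℕ} (hσ : IsSearchOrder T root σ)
    {S S' : Finset (MaxClique Gᶜ)} (hS : ConnectedIn T S) (hS' : ConnectedIn T S')
    (hdisj : Disjoint S S') {t t' : MaxClique Gᶜ} (ht : t ∈ S) (ht' : t' ∈ S')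
    (hmin : ∀ C ∈ S, σ t ≤ σ C) (hmin' : ∀ C ∈ S', σ t' ≤ σ C) (hlt : σ t' < σ t)
    {A B : MaxClique Gᶜ} {z x : V} (hA : A ∈ S) (hz : z ∈ A.verts) (hB : B ∈ S')
    (hx : x ∈ B.verts) (hzx : ¬G.Adj z x) :
    z ∈ t.verts ∧ ∃ P, T.Adj t P ∧ σ P < σ t ∧ x ∈ P.verts := by
  obtain ⟨C, hzC, hxC⟩ := MaxClique.exists_of_not_adj hzx
  have hac := hT.isTree.isAcyclic
  rw [Finset.disjoint_left] at hdisj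
  -- Only the first node `t'` of `S'` can have its parent outside `S'`, and that parent precedes
  -- `t'`, hence `t`.
  have below : ∀ D ∈ S', ∀ E, E ∉ S' → T.Adj D E → σ E < σ D → σ E < σ t := by
    intro D hD E hE hDE hED
    have := hσ.eq_min_of_parent_notMem hac hS' ht' hmin' hD hDE hED hE
    subst this
    exact hED.trans hlt
  by_cases hCS : C ∈ S
  · have hCS' := hdisj hCS
    have hBS : B ∉ S := fun h => hdisj h hB
    have hBC : T.Adj C B := hT.adj_of_mem h2 hxC hx fun h => hBS (h ▸ hCS)
    rcases lt_trichotomy (σ B) (σ C) with h | h | h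
    · obtain rfl := hσ.eq_min_of_parent_notMem hac hS ht hmin hCS hBC h hBS
      exact ⟨hzC, B, hBC, h, hx⟩
    · exact absurd (hσ.injective h) hBC.ne'
    · have := below B hB C hCS' hBC.symm h
      have := hmin C hCS
      omega
  · have hAC : T.Adj A C := hT.adj_of_mem h2 hz hzC fun h => hCS (h ▸ hA)
    rcases lt_trichotomy (σ C) (σ A) with h | h | h
    · obtain rfl := hσ.eq_min_of_parent_notMem hac hS ht hmin hA hAC h hCS
      exact ⟨hz, C, hAC, h, hxC⟩
    · exact absurd (hσ.injective h) hAC.ne'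
    -- Now `C` comes after `A`, hence after `t`. In `S'` it would have the earlier outside neighbour
    -- `A`, which does not precede `t`; outside `S'` it would be either a parent of `B` that comes
    -- after `t`, or a node with two parents `A` and `B`.
    · exfalso
      have hAS' := hdisj hA
      have hA' := hmin A hA
      by_cases hCS' : C ∈ S'
      · have := below C hCS' A hAS' hAC.symm h
        omega
      · have hBC : T.Adj B C := hT.adj_of_mem h2 hx hxC fun h => hCS' (h ▸ hB)
        rcases lt_trichotomy (σ C) (σ B) with h' | h' | h'
        · have := below B hB C hCS' hBC h'
          omega
        · exact hBC.ne (hσ.injective h').symm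
        · have := hσ.parent_unique hac hAC.symm h hBC.symm h'
          exact hAS' (this ▸ hB)

end CliqueTree

/-! ### The recursive subroutine -/

section FindBiclique

variable {V : Type u} [DecidableEq V] {H : SimpleGraph V} {T : SimpleGraph (MaxClique H)}
  {φ : Sym2 (MaxClique H) → ℕ} {σ : MaxClique H → ℕ} {r : ℕ}

theorem ConnectedIn.exists_max_edge {N : Type u} {T : SimpleGraph N} {S : Finset N}
    (hS : ConnectedIn T S) (hcard : 1 < S.card) (φ : Sym2 N → ℕ) :
    ∃ K₁ ∈ S, ∃ K₂ ∈ S, T.Adj K₁ K₂ ∧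
      ∀ A ∈ S, ∀ B ∈ S, T.Adj A B → φ s(A, B) ≤ φ s(K₁, K₂) := by
  classical
  obtain ⟨A, hA, B, hB, hne⟩ := Finset.one_lt_card.1 hcard
  obtain ⟨p, hp⟩ := hS A hA B hB
  have hedge : ((S ×ˢ S).filter fun q => T.Adj q.1 q.2).Nonempty := by
    cases p with
    | nil => exact absurd rfl hne
    | @cons _ C _ h q => exact ⟨(A, C), by simp [hA, h, hp C (by simp)]⟩
  obtain ⟨⟨K₁, K₂⟩, hK, hmax⟩ := Finset.exists_max_image _ (fun q => φ s(q.1, q.2)) hedge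
  simp only [Finset.mem_filter, Finset.mem_product] at hK hmax
  exact ⟨K₁, hK.1.1, K₂, hK.1.2, hK.2, fun A hA B hB h => hmax (A, B) ⟨⟨hA, hB⟩, h⟩⟩

theorem exists_findBiclique (hT : T.IsAcyclic) (S : Finset (MaxClique H))
    (hS : ConnectedIn T S) (D : LevelDict V) : ∃ D', FindBiclique T φ σ r S D D' := by
  induction S using Finset.strongInduction generalizing D with
  | H S ih =>
    by_cases hcard : 1 < S.card
    · obtain ⟨K₁, h₁, K₂, h₂, hadj, hmax⟩ := hS.exists_max_edge hcard φ
      have hss : ∀ {A B}, B ∈ S → T.Adj A B → cutSide T S A B ⊂ S := fun hB h =>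
        Finset.ssubset_iff_subset_ne.2 ⟨cutSide_subset _ _ _, fun he =>
          right_notMem_cutSide hT h (he.symm ▸ hB)⟩
      obtain ⟨D₁, hD₁⟩ := ih _ (hss h₂ hadj) (connectedIn_cutSide _ _ _) _
      obtain ⟨D₂, hD₂⟩ := ih _ (hss h₁ hadj.symm) (connectedIn_cutSide _ _ _) D₁
      exact ⟨D₂, .cut S D _ D₁ D₂ K₁ K₂ _ hcard h₁ h₂ hadj hmax rfl rfl hD₁ hD₂⟩
    · exact ⟨D, .done S D (by omega)⟩

/-- `y` is the entry that cutting the subtree `S` produces at level `i`. -/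
def IsCutEntry (T : SimpleGraph (MaxClique H)) (φ : Sym2 (MaxClique H) → ℕ)
    (σ : MaxClique H → ℕ) (r i : ℕ) (S : Finset (MaxClique H)) (y : Biclique V × ℕ) : Prop :=
  ConnectedIn T S ∧ (∃ t ∈ S, σ t = y.2 ∧ ∀ A ∈ S, σ t ≤ σ A) ∧
    ∃ K₁ ∈ S, ∃ K₂ ∈ S, T.Adj K₁ K₂ ∧ i = r + 1 - φ s(K₁, K₂) ∧
      y.1 = (sideVerts (cutSide T S K₁ K₂) K₁ K₂, sideVerts (cutSide T S K₂ K₁) K₁ K₂)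

theorem IsCutEntry.exists_mem {i : ℕ} {S : Finset (MaxClique H)} {y : Biclique V × ℕ}
    (h : IsCutEntry T φ σ r i S y) {x : V} (hx : x ∈ y.1.1 ∪ y.1.2) : ∃ A ∈ S, x ∈ A.verts := by
  obtain ⟨-, -, K₁, h₁, K₂, h₂, hadj, -, hy⟩ := h
  rw [hy, Finset.mem_union, mem_sideVerts, mem_sideVerts] at hx
  rcases hx with ⟨⟨A, hA, hxA⟩, -⟩ | ⟨⟨A, hA, hxA⟩, -⟩
  all_goals exact ⟨A, cutSide_subset _ _ _ hA, hxA⟩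

/-- At the level of the current cut both recursive calls add nothing, since the cut edge alone has
its rank; at any other level the entries of the two calls come from the two disjoint sides. -/
theorem FindBiclique.exists_entries (hT : T.IsAcyclic) (hφ : IsEdgeRanking T r φ)
    {S : Finset (MaxClique H)} {D D' : LevelDict V} (h : FindBiclique T φ σ r S D D')
    (hS : ConnectedIn T S) (i : ℕ) :
    ∃ w : List (Finset (MaxClique H) × (Biclique V × ℕ)), D' i = D i ++ w.map Prod.snd ∧
      (∀ q ∈ w, q.1 ⊆ S ∧ IsCutEntry T φ σ r i q.1 q.2) ∧
      w.Pairwise fun q q' => Disjoint q.1 q'.1 := by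
  induction h with
  | done S D hcard => exact ⟨[], by simp⟩
  | cut S D D₀ D₁ D₂ K₁ K₂ level hcard h₁ h₂ hadj hmax hlevel hD₀ _ _ ih₁ ih₂ =>
    obtain ⟨w₁, hw₁, hcut₁, hpw₁⟩ := ih₁ (connectedIn_cutSide _ _ _)
    obtain ⟨w₂, hw₂, hcut₂, hpw₂⟩ := ih₂ (connectedIn_cutSide _ _ _)
    -- As ranks lie between `1` and `r`, the subtraction in `r + 1 - φ` does not truncate, and equal
    -- levels mean equal ranks.
    have hr := hφ.1 s(K₁, K₂) hadj
    by_cases hi : i = level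
    · have hnil₁ : w₁ = [] := by
        refine List.eq_nil_iff_forall_not_mem.2 fun q hq => ?_
        obtain ⟨hsub, -, -, A, hA, B, hB, hAB, hAi, -⟩ := hcut₁ q hq
        have := hφ.lt_of_mem_cutSide hT hS h₂ hadj hmax (hsub hA) (hsub hB) hAB
        have := hφ.1 s(A, B) hAB
        omega
      have hnil₂ : w₂ = [] := by
        refine List.eq_nil_iff_forall_not_mem.2 fun q hq => ?_
        obtain ⟨hsub, -, -, A, hA, B, hB, hAB, hAi, -⟩ := hcut₂ q hq
        have hlt := hφ.lt_of_mem_cutSide hT hS h₁ hadj.symm (by rwa [Sym2.eq_swap])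
          (hsub hA) (hsub hB) hAB
        rw [Sym2.eq_swap (a := K₂)] at hlt
        have := hφ.1 s(A, B) hAB
        omega
      subst hnil₁ hnil₂ hi
      obtain ⟨t, ht, htσ⟩ := Finset.exists_mem_eq_inf' ⟨K₁, h₁⟩ σ
      refine ⟨[(S, _)], by rw [hw₂, hw₁, hD₀, Function.update_self]; simp; rfl, ?_, by simp⟩
      rintro q hq
      rw [List.mem_singleton] at hq
      subst hq
      exact ⟨subset_rfl, hS, ⟨t, ht, htσ.symm, fun A hA => htσ ▸ Finset.inf'_le σ hA⟩,
        K₁, h₁, K₂, h₂, hadj, hlevel, rfl⟩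
    · refine ⟨w₁ ++ w₂, by rw [hw₂, hw₁, hD₀, Function.update_of_ne hi]; simp, ?_, ?_⟩
      · intro q hq
        rcases List.mem_append.1 hq with hq | hq
        · exact ⟨(hcut₁ q hq).1.trans (cutSide_subset _ _ _), (hcut₁ q hq).2⟩
        · exact ⟨(hcut₂ q hq).1.trans (cutSide_subset _ _ _), (hcut₂ q hq).2⟩
      · exact List.pairwise_append.2 ⟨hpw₁, hpw₂, fun q hq q' hq' =>
          (disjoint_cutSide hT hadj).mono (hcut₁ q hq).1 (hcut₂ q' hq').1⟩

/-- The biclique `b` covers the edge `uv`. -/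
def Covers (b : Biclique V) (u v : V) : Prop :=
  (u ∈ b.1 ∧ v ∈ b.2) ∨ (v ∈ b.1 ∧ u ∈ b.2)

theorem FindBiclique.subset {S : Finset (MaxClique H)} {D D' : LevelDict V}
    (h : FindBiclique T φ σ r S D D') (i : ℕ) : D i ⊆ D' i := by
  induction h with
  | done => exact List.Subset.refl _
  | cut S D D₀ D₁ D₂ K₁ K₂ level _ _ _ _ _ _ hD₀ _ _ ih₁ ih₂ =>
    refine List.Subset.trans ?_ (List.Subset.trans ih₁ ih₂)
    by_cases hi : i = level
    · rw [hD₀, hi, Function.update_self]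
      exact List.subset_append_left _ _
    · rw [hD₀, Function.update_of_ne hi]
      exact List.Subset.refl _

theorem FindBiclique.exists_covers {u v : V}
    (huv : ∀ K : MaxClique H, u ∈ K.verts → v ∉ K.verts)
    {S : Finset (MaxClique H)} {D D' : LevelDict V} (h : FindBiclique T φ σ r S D D')
    (hS : ConnectedIn T S) (hu : ∃ A ∈ S, u ∈ A.verts) (hv : ∃ B ∈ S, v ∈ B.verts) :
    ∃ i, ∃ y ∈ D' i, Covers y.1 u v := by
  induction h with
  | done S D hcard =>
    obtain ⟨A, hA, huA⟩ := hu
    obtain ⟨B, hB, hvB⟩ := hv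
    obtain rfl := Finset.card_le_one.1 hcard A hA B hB
    exact absurd hvB (huv A huA)
  | cut S D D₀ D₁ D₂ K₁ K₂ level hcard h₁ h₂ hadj hmax hlevel hD₀ hrec₁ hrec₂ ih₁ ih₂ =>
    have ih₁ := ih₁ (connectedIn_cutSide _ _ _)
    have ih₂ := ih₂ (connectedIn_cutSide _ _ _)
    have lift₁ : (∃ i, ∃ y ∈ D₁ i, Covers y.1 u v) → ∃ i, ∃ y ∈ D₂ i, Covers y.1 u v :=
      fun ⟨i, y, hy, hc⟩ => ⟨i, y, hrec₂.subset i hy, hc⟩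
    have hnew : ((sideVerts (cutSide T S K₁ K₂) K₁ K₂, sideVerts (cutSide T S K₂ K₁) K₁ K₂),
        S.inf' ⟨K₁, h₁⟩ σ) ∈ D₂ level := by
      refine hrec₂.subset _ (hrec₁.subset _ ?_)
      rw [hD₀, Function.update_self]
      simp
    have hK₁ : K₁ ∈ cutSide T S K₁ K₂ := left_mem_cutSide h₁
    have hK₂ : K₂ ∈ cutSide T S K₂ K₁ := left_mem_cutSide h₂
    obtain ⟨A, hA, huA⟩ := hu
    obtain ⟨B, hB, hvB⟩ := hv
    -- A vertex of the middle set occurs in both parts, so the recursion follows the other vertex.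
    by_cases hmu : u ∈ K₁.verts ∧ u ∈ K₂.verts
    · rcases mem_cutSide_or (K₂ := K₂) hS h₁ hB with hB | hB
      · exact lift₁ (ih₁ ⟨K₁, hK₁, hmu.1⟩ ⟨B, hB, hvB⟩)
      · exact ih₂ ⟨K₂, hK₂, hmu.2⟩ ⟨B, hB, hvB⟩
    by_cases hmv : v ∈ K₁.verts ∧ v ∈ K₂.verts
    · rcases mem_cutSide_or (K₂ := K₂) hS h₁ hA with hA | hA
      · exact lift₁ (ih₁ ⟨A, hA, huA⟩ ⟨K₁, hK₁, hmv.1⟩)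
      · exact ih₂ ⟨A, hA, huA⟩ ⟨K₂, hK₂, hmv.2⟩
    rcases mem_cutSide_or (K₂ := K₂) hS h₁ hA with hA | hA <;>
      rcases mem_cutSide_or (K₂ := K₂) hS h₁ hB with hB | hB
    · exact lift₁ (ih₁ ⟨A, hA, huA⟩ ⟨B, hB, hvB⟩)
    · exact ⟨level, _, hnew, Or.inl ⟨mem_sideVerts.2 ⟨⟨A, hA, huA⟩, hmu⟩,
        mem_sideVerts.2 ⟨⟨B, hB, hvB⟩, hmv⟩⟩⟩
    · exact ⟨level, _, hnew, Or.inr ⟨mem_sideVerts.2 ⟨⟨B, hB, hvB⟩, hmv⟩,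
        mem_sideVerts.2 ⟨⟨A, hA, huA⟩, hmu⟩⟩⟩
    · exact ih₂ ⟨A, hA, huA⟩ ⟨B, hB, hvB⟩

end FindBiclique

/-! ### The merging subroutine -/

section Merge

variable {V : Type u}

theorem Covers.mono {b c : Biclique V} {u v : V} (h : Covers b u v) (h₁ : b.1 ⊆ c.1)
    (h₂ : b.2 ⊆ c.2) : Covers c u v :=
  h.imp (And.imp (@h₁ _) (@h₂ _)) (And.imp (@h₁ _) (@h₂ _))

theorem Covers.swap {b : Biclique V} {u v : V} (h : Covers b u v) : Covers b.swap u v :=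
  h.symm.imp And.symm And.symm

variable [DecidableEq V] {G : SimpleGraph V}

theorem mergeInto_of_mergeable {b c : Biclique V} (h : Mergeable G b c) :
    IsBiclique G (mergeInto G b c) ∧
      (mergeInto G b c = (b.1 ∪ c.1, b.2 ∪ c.2) ∨ mergeInto G b c = (b.2 ∪ c.1, b.1 ∪ c.2)) := by
  unfold mergeInto
  split_ifs with h₁ h₂
  · exact ⟨h₁, Or.inl rfl⟩
  · exact ⟨h₂, Or.inr rfl⟩
  · exact absurd h (not_or.2 ⟨h₁, h₂⟩)

/-- If all conflicts between two bicliques involve only one side of the first one, and only vertices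
of the second one that are pairwise non-adjacent, then the bicliques can be merged. -/
theorem mergeable_of_conflict {b c : Biclique V} (hb : IsBiclique G b) (hc : IsBiclique G c)
    {Z : Finset V} (hZ : Z = b.1 ∨ Z = b.2) {P : Set V} (hP : ∀ x ∈ P, ∀ y ∈ P, ¬G.Adj x y)
    (hconf : ∀ z ∈ b.1 ∪ b.2, ∀ x ∈ c.1 ∪ c.2, ¬G.Adj z x → z ∈ Z ∧ x ∈ P) :
    Mergeable G b c := by
  obtain ⟨b₁, b₂⟩ := b
  obtain ⟨c₁, c₂⟩ := c
  obtain ⟨⟨x₁, hx₁⟩, ⟨x₂, hx₂⟩, hb⟩ := hb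
  obtain ⟨-, -, hc⟩ := hc
  simp only [Finset.mem_union] at *
  -- Vertices of `P` on both sides of `c` would be adjacent.
  have sep : (∀ x ∈ c₁, x ∉ P) ∨ ∀ x ∈ c₂, x ∉ P := by
    by_contra! h
    obtain ⟨⟨x, hx, hxP⟩, y, hy, hyP⟩ := h
    exact hP x hxP y hyP (hc x hx y hy)
  have hZ' : (∀ z ∈ b₁, z ∉ Z) ∨ ∀ z ∈ b₂, z ∉ Z := by
    rcases hZ with rfl | rfl
    · exact Or.inr fun z hz hz' => (hb z hz' z hz).ne rfl
    · exact Or.inl fun z hz hz' => (hb z hz z hz').ne rfl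
  have direct : (∀ z ∈ b₁, ∀ x ∈ c₂, G.Adj z x) → (∀ z ∈ b₂, ∀ x ∈ c₁, G.Adj z x) →
      Mergeable G (b₁, b₂) (c₁, c₂) := by
    refine fun h h' => Or.inl ⟨⟨x₁, by simp [hx₁]⟩, ⟨x₂, by simp [hx₂]⟩, fun u hu v hv => ?_⟩
    simp only [Finset.mem_union] at hu hv
    rcases hu with hu | hu <;> rcases hv with hv | hv
    exacts [hb u hu v hv, h u hu v hv, (h' v hv u hu).symm, hc u hu v hv]
  have crossed : (∀ z ∈ b₂, ∀ x ∈ c₂, G.Adj z x) → (∀ z ∈ b₁, ∀ x ∈ c₁, G.Adj z x) →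
      Mergeable G (b₁, b₂) (c₁, c₂) := by
    refine fun h h' => Or.inr ⟨⟨x₂, by simp [hx₂]⟩, ⟨x₁, by simp [hx₁]⟩, fun u hu v hv => ?_⟩
    simp only [Finset.mem_union] at hu hv
    rcases hu with hu | hu <;> rcases hv with hv | hv
    exacts [(hb v hv u hu).symm, h u hu v hv, (h' v hv u hu).symm, hc u hu v hv]
  have adj : ∀ z, (z ∈ b₁ ∨ z ∈ b₂) → ∀ x, (x ∈ c₁ ∨ x ∈ c₂) → (z ∉ Z ∨ x ∉ P) →
      G.Adj z x := by
    intro z hz x hx h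
    by_contra hadj
    have := hconf z hz x hx hadj
    tauto
  -- In each case conflicts remain between one side of `b` and one side of `c` only; the orientation
  -- chosen unites those two sides.
  rcases sep with hc₁ | hc₂ <;> rcases hZ' with hb₁ | hb₂
  · exact direct (fun z hz x hx => adj z (.inl hz) x (.inr hx) (.inl (hb₁ z hz)))
      (fun z hz x hx => adj z (.inr hz) x (.inl hx) (.inr (hc₁ x hx)))
  · exact crossed (fun z hz x hx => adj z (.inr hz) x (.inr hx) (.inl (hb₂ z hz)))
      (fun z hz x hx => adj z (.inl hz) x (.inl hx) (.inr (hc₁ x hx)))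
  · exact crossed (fun z hz x hx => adj z (.inr hz) x (.inr hx) (.inr (hc₂ x hx)))
      (fun z hz x hx => adj z (.inl hz) x (.inl hx) (.inl (hb₁ z hz)))
  · exact direct (fun z hz x hx => adj z (.inl hz) x (.inr hx) (.inr (hc₂ x hx)))
      (fun z hz x hx => adj z (.inr hz) x (.inl hx) (.inl (hb₂ z hz)))

/-- All conflicts of the entry `y` with entries of `l` that have a smaller key involve only one side
of `y`, and only vertices of those entries in a set of pairwise non-adjacent vertices. -/
def ConflictsConfined (G : SimpleGraph V) (l : List (Biclique V × ℕ)) (y : Biclique V × ℕ) :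
    Prop :=
  ∃ (Z : Finset V) (P : Set V), (Z = y.1.1 ∨ Z = y.1.2) ∧ (∀ x ∈ P, ∀ x' ∈ P, ¬G.Adj x x') ∧
    ∀ y' ∈ l, y'.2 < y.2 → ∀ z ∈ y.1.1 ∪ y.1.2, ∀ x ∈ y'.1.1 ∪ y'.1.2, ¬G.Adj z x →
      z ∈ Z ∧ x ∈ P

/-- The middle clause serves the induction: every vertex of the accumulated biclique comes from an
earlier entry, so its conflicts with the next entry are confined by hypothesis. Strict sorting makes
every earlier entry count as one of smaller key. -/
theorem foldl_mergeStep {l : List (Biclique V × ℕ)} (hsort : l.Pairwise fun y y' => y.2 < y'.2)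
    (hbi : ∀ y ∈ l, IsBiclique G y.1) (hconf : ∀ y ∈ l, ConflictsConfined G l y) :
    ((l.map Prod.fst).foldl (mergeStep G) ∅).card ≤ 1 ∧
    (∀ c ∈ (l.map Prod.fst).foldl (mergeStep G) ∅, IsBiclique G c ∧
      ∀ x ∈ c.1 ∪ c.2, ∃ y ∈ l, x ∈ y.1.1 ∪ y.1.2) ∧
    ∀ y ∈ l, ∀ u v, Covers y.1 u v →
      ∃ c ∈ (l.map Prod.fst).foldl (mergeStep G) ∅, Covers c u v := by
  induction l using List.reverseRecOn with
  | nil => simp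
  | append_singleton l y ih =>
    rw [List.pairwise_append] at hsort
    have hlt : ∀ y' ∈ l, y'.2 < y.2 := fun y' hy' => hsort.2.2 y' hy' y (by simp)
    have hby := hbi y (by simp)
    obtain ⟨Z, P, hZ, hP, hyc⟩ := hconf y (by simp)
    obtain ⟨hcard, hC, hcov⟩ := ih hsort.1 (fun y hy => hbi y (by simp [hy])) fun y' hy' => by
      obtain ⟨Z, P, hZ, hP, h⟩ := hconf y' (by simp [hy'])
      exact ⟨Z, P, hZ, hP, fun y'' hy'' => h y'' (by simp [hy''])⟩
    rw [List.map_append, List.foldl_append, List.map_singleton, List.foldl_cons, List.foldl_nil]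
    rcases Nat.le_one_iff_eq_zero_or_eq_one.1 hcard with h | h
    · rw [Finset.card_eq_zero] at h
      rw [h] at hcov ⊢
      have hstep : mergeStep G ∅ y.1 = {y.1} := by simp [mergeStep]
      rw [hstep]
      refine ⟨by simp, fun c hc => ?_, fun y' hy' u v huv => ⟨y.1, by simp, ?_⟩⟩
      · rw [Finset.mem_singleton] at hc
        subst hc
        exact ⟨hby, fun x hx => ⟨y, by simp, hx⟩⟩
      · rcases List.mem_append.1 hy' with hy' | hy'
        · obtain ⟨c, hc, -⟩ := hcov y' hy' u v huv
          simp at hc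
        · rw [List.mem_singleton] at hy'
          exact hy' ▸ huv
    · obtain ⟨c, hcC⟩ := Finset.card_eq_one.1 h
      rw [hcC] at hC hcov ⊢
      obtain ⟨hcb, hcl⟩ := hC c (by simp)
      have hm : Mergeable G y.1 c := by
        refine mergeable_of_conflict hby hcb hZ hP fun z hz x hx hzx => ?_
        obtain ⟨y', hy', hx'⟩ := hcl x hx
        exact hyc y' (by simp [hy']) (hlt y' hy') z hz x hx' hzx
      have hstep : mergeStep G {c} y.1 = {mergeInto G y.1 c} := by simp [mergeStep, hm]
      rw [hstep]
      obtain ⟨hmb, hme⟩ := mergeInto_of_mergeable hm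
      refine ⟨by simp, fun c' hc' => ?_, fun y' hy' u v huv => ⟨_, Finset.mem_singleton_self _, ?_⟩⟩
      · rw [Finset.mem_singleton] at hc'
        subst hc'
        refine ⟨hmb, fun x hx => ?_⟩
        have hx' : x ∈ y.1.1 ∪ y.1.2 ∨ x ∈ c.1 ∪ c.2 := by
          rcases hme with he | he <;> rw [he] at hx <;> simp only [Finset.mem_union] at hx ⊢ <;>
            tauto
        rcases hx' with hx | hx
        · exact ⟨y, by simp, hx⟩
        · obtain ⟨y', hy', h⟩ := hcl x hx
          exact ⟨y', by simp [hy'], h⟩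
      · rcases List.mem_append.1 hy' with hy' | hy'
        · obtain ⟨c', hc', huv'⟩ := hcov y' hy' u v huv
          rw [Finset.mem_singleton] at hc'
          subst hc'
          rcases hme with he | he <;> rw [he] <;>
            exact huv'.mono Finset.subset_union_right Finset.subset_union_right
        · rw [List.mem_singleton] at hy'
          subst hy'
          rcases hme with he | he <;> rw [he]
          · exact huv.mono Finset.subset_union_left Finset.subset_union_left
          · exact huv.swap.mono Finset.subset_union_left Finset.subset_union_left

theorem mergeBiclique_spec {l : List (Biclique V × ℕ)} (hkeys : l.Pairwise fun y y' => y.2 ≠ y'.2)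
    (hbi : ∀ y ∈ l, IsBiclique G y.1) (hconf : ∀ y ∈ l, ConflictsConfined G l y) :
    (mergeBiclique G l).card ≤ 1 ∧ (∀ c ∈ mergeBiclique G l, IsBiclique G c) ∧
    ∀ y ∈ l, ∀ u v, Covers y.1 u v → ∃ c ∈ mergeBiclique G l, Covers c u v := by
  have hle : (l.mergeSort fun x y => decide (x.2 ≤ y.2)).Pairwise fun y y' => y.2 ≤ y'.2 := by
    have := List.pairwise_mergeSort (le := fun x y : Biclique V × ℕ => decide (x.2 ≤ y.2))
      (fun a b c h h' => by simp only [decide_eq_true_eq] at *; omega)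
      (fun a b => by simp only [Bool.or_eq_true, decide_eq_true_eq]; omega) l
    exact this.imp fun h => by simpa using h
  have hne : (l.mergeSort fun x y => decide (x.2 ≤ y.2)).Pairwise fun y y' => y.2 ≠ y'.2 :=
    (List.mergeSort_perm l _).symm.pairwise hkeys fun h => h.symm
  have hmem := fun y => List.mem_mergeSort (a := y) (l := l)
    (le := fun x y => decide (x.2 ≤ y.2))
  obtain ⟨h₁, h₂, h₃⟩ := foldl_mergeStep (G := G)
    (hle.imp₂ (fun _ _ h h' => lt_of_le_of_ne h h') hne)
    (fun y hy => hbi y ((hmem y).1 hy)) fun y hy => by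
      obtain ⟨Z, P, hZ, hP, h⟩ := hconf y ((hmem y).1 hy)
      exact ⟨Z, P, hZ, hP, fun y' hy' => h y' ((hmem y').1 hy')⟩
  exact ⟨h₁, fun c hc => (h₂ c hc).1, fun y hy => h₃ y ((hmem y).2 hy)⟩

end Merge

/-! ### The algorithm -/

section Algorithm

variable {V : Type u} [Fintype V] [DecidableEq V] {G : SimpleGraph V}
  {T : SimpleGraph (MaxClique Gᶜ)} {φ : Sym2 (MaxClique Gᶜ) → ℕ} {σ : MaxClique Gᶜ → ℕ}
  {r i : ℕ}

theorem IsCutEntry.isBiclique (hT : IsCliqueTree Gᶜ T) {S : Finset (MaxClique Gᶜ)}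
    {y : Biclique V × ℕ} (h : IsCutEntry T φ σ r i S y) : IsBiclique G y.1 := by
  obtain ⟨-, -, K₁, h₁, K₂, h₂, hadj, -, hy⟩ := h
  exact hy ▸ hT.isBiclique_cut h₁ h₂ hadj

/-- With `t` the first node of the subtree of `y`, the side `Z` is the one whose part contains `t`,
and `P` consists of the vertices in the parent of `t`. -/
theorem conflictsConfined_of_isCutEntry (h2 : InAtMostTwoMaxIndepSets G) (hT : IsCliqueTree Gᶜ T)
    {root : MaxClique Gᶜ} (hσ : IsSearchOrder T root σ)
    {w : List (Finset (MaxClique Gᶜ) × (Biclique V × ℕ))}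
    (hw : ∀ q ∈ w, IsCutEntry T φ σ r i q.1 q.2) (hpw : w.Pairwise fun q q' => Disjoint q.1 q'.1)
    {y : Biclique V × ℕ} (hy : y ∈ w.map Prod.snd) :
    ConflictsConfined G (w.map Prod.snd) y := by
  obtain ⟨q, hq, rfl⟩ := List.mem_map.1 hy
  obtain ⟨hS, ⟨t, ht, htσ, hmin⟩, K₁, h₁, K₂, h₂, hadj, -, hqe⟩ := hw q hq
  have hside : ∃ Z, (Z = q.2.1.1 ∨ Z = q.2.1.2) ∧
      ∀ z ∈ q.2.1.1 ∪ q.2.1.2, z ∈ t.verts → z ∈ Z := by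
    have hmid : ∀ z ∈ q.2.1.1 ∪ q.2.1.2, ¬(z ∈ K₁.verts ∧ z ∈ K₂.verts) := by
      intro z hz
      rw [hqe, Finset.mem_union, mem_sideVerts, mem_sideVerts] at hz
      exact hz.elim And.right And.right
    rcases mem_cutSide_or (K₂ := K₂) hS h₁ ht with h | h
    · refine ⟨_, Or.inl rfl, fun z hz hzt => ?_⟩
      rw [hqe]
      exact mem_sideVerts.2 ⟨⟨t, h, hzt⟩, hmid z hz⟩
    · refine ⟨_, Or.inr rfl, fun z hz hzt => ?_⟩
      rw [hqe]
      exact mem_sideVerts.2 ⟨⟨t, h, hzt⟩, hmid z hz⟩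
  obtain ⟨Z, hZ, hZt⟩ := hside
  refine ⟨Z, {x | ∃ P, T.Adj t P ∧ σ P < σ t ∧ x ∈ P.verts}, hZ, ?_, ?_⟩
  · rintro x ⟨P, hP, hPt, hxP⟩ x' ⟨Q, hQ, hQt, hxQ⟩
    obtain rfl := hσ.parent_unique hT.isTree.isAcyclic hP hPt hQ hQt
    exact P.not_adj hxP hxQ
  · intro y' hy' hlt z hz x hx hzx
    obtain ⟨q', hq', rfl⟩ := List.mem_map.1 hy'
    obtain ⟨A, hA, hzA⟩ := (hw q hq).exists_mem hz
    obtain ⟨B, hB, hxB⟩ := (hw q' hq').exists_mem hx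
    obtain ⟨hS', ⟨t', ht', htσ', hmin'⟩, -⟩ := hw q' hq'
    have : Std.Symm fun q q' : Finset (MaxClique Gᶜ) × (Biclique V × ℕ) => Disjoint q.1 q'.1 :=
      ⟨fun _ _ h => h.symm⟩
    have hdisj : Disjoint q.1 q'.1 :=
      hpw.forall hq hq' (by rintro rfl; exact lt_irrefl _ hlt)
    obtain ⟨hzt, hxP⟩ := hT.conflict_mem_parent h2 hσ hS hS' hdisj ht ht' hmin hmin'
      (by rw [htσ, htσ']; exact hlt) hA hzA hB hxB hzx
    exact ⟨hZt z hz hzt, hxP⟩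

theorem exists_algorithmReturns (hT : IsCliqueTree Gᶜ T) (φ : Sym2 (MaxClique Gᶜ) → ℕ)
    (σ : MaxClique Gᶜ → ℕ) : ∃ C, AlgorithmReturns G T φ σ C := by
  obtain ⟨D, hD⟩ := exists_findBiclique (φ := φ) (σ := σ) (r := edgeRankingNumber T)
    hT.isTree.isAcyclic Finset.univ (connectedIn_univ hT.isTree.connected) fun _ => []
  exact ⟨_, D, hD, rfl⟩

theorem AlgorithmReturns.isBicliqueCover (h2 : InAtMostTwoMaxIndepSets G)
    (hT : IsCliqueTree Gᶜ T) (hφ : IsOptimalEdgeRanking T φ) {root : MaxClique Gᶜ}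
    (hσ : IsBFSOrdering T root σ) {C : Finset (Biclique V)} (hC : AlgorithmReturns G T φ σ C) :
    IsBicliqueCover G C ∧ C.card ≤ edgeRankingNumber T := by
  obtain ⟨D, hD, rfl⟩ := hC
  have hσ := hσ.isSearchOrder hT.isTree.connected
  have huniv := connectedIn_univ hT.isTree.connected
  have hentries := hD.exists_entries hT.isTree.isAcyclic hφ huniv
  simp only [List.nil_append] at hentries
  have hspec : ∀ i, (mergeBiclique G (D i)).card ≤ 1 ∧
      (∀ c ∈ mergeBiclique G (D i), IsBiclique G c) ∧
      ∀ y ∈ D i, ∀ u v, Covers y.1 u v → ∃ c ∈ mergeBiclique G (D i), Covers c u v := by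
    intro i
    obtain ⟨w, hw, hcut, hpw⟩ := hentries i
    rw [hw]
    refine mergeBiclique_spec ?_ ?_ fun y hy =>
      conflictsConfined_of_isCutEntry h2 hT hσ (fun q hq => (hcut q hq).2) hpw hy
    · rw [List.pairwise_map]
      -- Keys are numbers of first nodes, so equal keys would give disjoint subtrees a common node.
      refine hpw.imp_of_mem fun {q q'} hq hq' hdisj heq => ?_
      obtain ⟨-, -, ⟨t, ht, htσ, -⟩, -⟩ := hcut q hq
      obtain ⟨-, -, ⟨t', ht', htσ', -⟩, -⟩ := hcut q' hq'
      obtain rfl : t = t' := hσ.injective (by rw [htσ, htσ', heq])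
      exact Finset.disjoint_left.1 hdisj ht ht'
    · intro y hy
      obtain ⟨q, hq, rfl⟩ := List.mem_map.1 hy
      exact (hcut q hq).2.isBiclique hT
  refine ⟨⟨fun b hb => ?_, fun u v huv => ?_⟩, ?_⟩
  · obtain ⟨i, -, hb⟩ := Finset.mem_biUnion.1 hb
    exact (hspec i).2.1 b hb
  · obtain ⟨A, hA, -⟩ := MaxClique.exists_of_not_adj (G.irrefl (v := u))
    obtain ⟨B, hB, -⟩ := MaxClique.exists_of_not_adj (G.irrefl (v := v))
    obtain ⟨i, y, hy, hc⟩ := hD.exists_covers (fun K hu hv => K.not_adj hu hv huv) huniv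
      ⟨A, Finset.mem_univ _, hA⟩ ⟨B, Finset.mem_univ _, hB⟩
    obtain ⟨c, hcC, hc'⟩ := (hspec i).2.2 y hy u v hc
    refine ⟨c, Finset.mem_biUnion.2 ⟨i, ?_, hcC⟩, hc'⟩
    -- The covering entry comes from an edge of rank between `1` and `r`, so its level is among
    -- those collected.
    obtain ⟨w, hw, hcut, -⟩ := hentries i
    rw [hw] at hy
    obtain ⟨q, hq, rfl⟩ := List.mem_map.1 hy
    obtain ⟨-, -, -, K₁, -, K₂, -, hadj, hi, -⟩ := hcut q hq
    have := hφ.1 s(K₁, K₂) hadj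
    rw [Finset.mem_Icc]
    omega
  · have := Finset.card_biUnion_le_card_mul (Finset.Icc 1 (edgeRankingNumber T))
      (fun i => mergeBiclique G (D i)) 1 fun i _ => (hspec i).1
    simpa using this

end Algorithm

end BicliqueBound

open BicliqueBound
theorem mainTheorem3 {V : Type*} [Fintype V] [DecidableEq V] (G : SimpleGraph V)
    (hG : IsCoChordal G) (h2 : InAtMostTwoMaxIndepSets G)
    (T : SimpleGraph (MaxClique Gᶜ)) (hT : IsCliqueTree Gᶜ T) :
    -- the choices that the algorithm makes are possible
    (∃ φ, IsOptimalEdgeRanking T φ) ∧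
    (∃ root σ, IsLeaf T root ∧ IsBFSOrdering T root σ) ∧
    -- however they are made, the algorithm returns a small biclique cover
    (∀ φ root σ, IsOptimalEdgeRanking T φ → IsLeaf T root → IsBFSOrdering T root σ →
      (∃ C, AlgorithmReturns G T φ σ C) ∧
      ∀ C, AlgorithmReturns G T φ σ C →
        IsBicliqueCover G C ∧ C.card ≤ edgeRankingNumber T) ∧
    bicliqueCoverNumber G ≤ edgeRankingNumber T := by
  obtain ⟨φ, hφ⟩ := exists_isOptimalEdgeRanking T
  obtain ⟨root, hroot⟩ := exists_isLeaf hT.isTree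
  obtain ⟨σ, hσ⟩ := exists_isBFSOrdering T root
  obtain ⟨C, hC⟩ := exists_algorithmReturns hT φ σ
  have hcover := hC.isBicliqueCover h2 hT hφ hσ
  refine ⟨⟨φ, hφ⟩, ⟨root, σ, hroot, hσ⟩, fun φ root σ hφ _ hσ =>
    ⟨exists_algorithmReturns hT φ σ, fun C hC => hC.isBicliqueCover h2 hT hφ hσ⟩, ?_⟩
  have hle : bicliqueCoverNumber G ≤ C.card := Nat.sInf_le ⟨C, hcover.1, rfl⟩
  exact hle.trans hcover.2
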